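/- **Setting.** There are finitely many machines $u$ with speeds $s(u)\ge 0$, known in advance, and finitely many jobs arriving one by one in an order and with sizes $w(v)>0$ fixed in advance by an adversary (who does not see the algorithm's random choices). When a job arrives its size is revealed, and it is assigned irrevocably to at most one machine; any job may be assigned to any machine, and the edge $(u,v)$ has weight $s(u)w(v)$. With free disposal, the reward of machine $u$ is $s(u)$ times the size of the largest job ever assigned to $u$ ($0$ if there is none), and the value of an assignment is the sum of the rewards. Let $\mathrm{OPT}$ be the maximum value over all assignments of the jobs to the machines. A randomized algorithm is called $\alpha$-competitive if on every instance its value $A$ satisfies $\mathbb{E}[A]\ge\alpha\cdot\mathrm{OPT}$. **Algorithm with parameter $c>1$.** Each machine $i$ independently picks an offset $x_i$ uniformly at random in $(0,1]$. For machine $i$, every size $w>0$ lies in exactly one interval $(c^{k+x_i},c^{k+1+x_i}]$, $k\in\mathbb{Z}$. When a job of size $w$ arrives, the machines are checked in order of decreasing speed (ties between equal speeds are broken in an arbitrary fixed way), and the job is assigned to the first machine $i$ to which no job in the same interval as $w$ or in an interval with larger $k$ (with respect to $x_i$) has been assigned so far. If there is no such machine, the job is not assigned. **Theorem.** For $c\ge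 e$ put $$\beta=\frac{c\ln c}{c-1}-1,\qquad h(c)=1-\frac1\beta\,W\!\left(\frac{\beta e^{\beta}}{c}\right),$$ where $W$ is the Lambert function (the principal branch of the inverse of $x\mapsto xe^x$). Then for every $c\ge e$ the algorithm with parameter $c$ is $\alpha$-competitive for $$\alpha=\min\left(\frac{c-1}{c\ln c},\,h(c)\right).$$ For $c=3.55829$ this minimum lies strictly between $0.5664$ and $0.5665$; in particular, the algorithm with this $c$ is $0.5664$-competitive, which is strictly better than $0.5$. -/

import Mathlib

noncomputable section

namespace OnlineMatching

/-! ### Rewards and the offline optimum -/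

/-- Size of the largest job in a list of (positive) job sizes; `0` if the list is empty. -/
def maxSize (held : List ℝ) : ℝ := held.foldr max 0

/-- Total reward: each machine `u`, with speed `s u`, gets credit for the largest job among the jobs
`held u` assigned to it (free disposal). The edge between `u` and a job of size `w` has weight
`s u * w`. -/
def reward {n : ℕ} (s : Fin n → ℝ) (held : Fin n → List ℝ) : ℝ :=
  ∑ u, s u * maxSize (held u)

/-- The job sizes that each machine receives when job `j` goes to machine `f j`
(`none`: to no machine). -/
def heldBy {n m : ℕ} (w : Fin m → ℝ) (f : Fin m → Option (Fin n)) (u : Fin n) : List ℝ :=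
  ((List.finRange m).filter (fun j => f j = some u)).map w

/-- The offline optimum: the best reward over all (finitely many) assignments of jobs to machines. -/
def opt {n m : ℕ} (s : Fin n → ℝ) (w : Fin m → ℝ) : ℝ :=
  ⨆ f : Fin m → Option (Fin n), reward s (heldBy w f)

theorem opt_isGreatest {n m : ℕ} (s : Fin n → ℝ) (w : Fin m → ℝ) :
    IsGreatest (Set.range fun f : Fin m → Option (Fin n) => reward s (heldBy w f)) (opt s w) := by
  refine ⟨?_, ?_⟩
  · exact exists_eq_ciSup_of_finite
  · rintro _ ⟨f, rfl⟩
    exact le_ciSup (f := fun f : Fin m → Option (Fin n) => reward s (heldBy w f))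
      (Set.finite_range _).bddAbove f

/-! ### The randomized doubling algorithm -/

/-- The index `k` of the interval `(c ^ (k + x), c ^ (k + 1 + x)]` that contains the size `w`. -/
def intervalIndex (c x w : ℝ) : ℤ := ⌈Real.logb c w - x⌉ - 1

/-- `intervalIndex c x w` is the unique `k` with `w ∈ (c ^ (k + x), c ^ (k + 1 + x)]`. -/
theorem mem_interval_iff {c x w : ℝ} (hc : 1 < c) (hw : 0 < w) (k : ℤ) :
    w ∈ Set.Ioc (c ^ ((k : ℝ) + x)) (c ^ ((k : ℝ) + 1 + x)) ↔ k = intervalIndex c x w := by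
  rw [Set.mem_Ioc, ← Real.lt_logb_iff_rpow_lt hc hw, ← Real.logb_le_iff_le_rpow hc hw,
    intervalIndex, eq_sub_iff_add_eq, eq_comm (b := ⌈_⌉), Int.ceil_eq_iff]
  push_cast
  constructor <;> rintro ⟨h₁, h₂⟩ <;> constructor <;> linarith

/-- A machine with offset `x` that has received the jobs `held` takes a job of size `w` iff it has no
job in the interval of `w` or in a bigger one. -/
def Accepts (c x : ℝ) (held : List ℝ) (w : ℝ) : Prop :=
  ∀ v ∈ held, intervalIndex c x v < intervalIndex c x w

open Classical in
/-- Arrival of a job of size `w`: it goes to the first machine in `order` that accepts it, and to no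
machine if none does. -/
def step {n : ℕ} (c : ℝ) (order : List (Fin n)) (x : Fin n → ℝ)
    (held : Fin n → List ℝ) (w : ℝ) : Fin n → List ℝ :=
  match order.find? (fun u => decide (Accepts c (x u) (held u) w)) with
  | some u => Function.update held u (w :: held u)
  | none => held

/-- The jobs that each machine has received after the jobs `w 0, w 1, …` have arrived in this
order, when the machines are checked in the order `order` and have offsets `x`. -/
def run {n m : ℕ} (c : ℝ) (order : List (Fin n)) (x : Fin n → ℝ) (w : Fin m → ℝ) :
    Fin n → List ℝ :=
  (List.ofFn w).foldl (step c order x) (fun _ => [])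

/-- `order` lists every machine exactly once, by decreasing speed, with ties in any order. -/
def IsSpeedOrder {n : ℕ} (s : Fin n → ℝ) (order : List (Fin n)) : Prop :=
  order.Nodup ∧ (∀ u, u ∈ order) ∧ order.Pairwise (fun u v => s v ≤ s u)

/-- The law of independent offsets, each uniform on `(0, 1]`. -/
def offsetLaw (n : ℕ) : MeasureTheory.Measure (Fin n → ℝ) :=
  MeasureTheory.Measure.pi fun _ => MeasureTheory.volume.restrict (Set.Ioc (0 : ℝ) 1)

/-- The algorithm with parameter `c` is `α`-competitive: on every instance, and for every way to
break ties between machines of equal speed, its expected reward is at least `α` times the offline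
optimum. -/
def IsCompetitive (c α : ℝ) : Prop :=
  ∀ (n m : ℕ) (s : Fin n → ℝ) (order : List (Fin n)) (w : Fin m → ℝ),
    (∀ u, 0 ≤ s u) → (∀ j, 0 < w j) → IsSpeedOrder s order →
      MeasureTheory.Integrable (fun x => reward s (run c order x w)) (offsetLaw n) ∧
      α * opt s w ≤ ∫ x, reward s (run c order x w) ∂(offsetLaw n)

/-! ### The ratio -/

/-- The Lambert function (principal branch): the inverse of `x ↦ x * exp x` on `[-1, ∞)`. -/
def lambertW (y : ℝ) : ℝ := Function.invFunOn (fun x : ℝ => x * Real.exp x) (Set.Ici (-1)) y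

theorem lambertW_spec {y : ℝ} (hy : 0 ≤ y) :
    -1 ≤ lambertW y ∧ lambertW y * Real.exp (lambertW y) = y := by
  have h : ∃ x ∈ Set.Ici (-1 : ℝ), x * Real.exp x = y := by
    have hcont : ContinuousOn (fun x : ℝ => x * Real.exp x) (Set.Icc 0 y) := by fun_prop
    obtain ⟨x, hx, hxy⟩ := intermediate_value_Icc hy hcont
      ⟨by simpa using hy, le_mul_of_one_le_right hy (Real.one_le_exp hy)⟩
    exact ⟨x, by simp only [Set.mem_Ici]; linarith [hx.1], hxy⟩
  exact ⟨Function.invFunOn_mem (f := fun x : ℝ => x * Real.exp x) h,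
    Function.invFunOn_eq (f := fun x : ℝ => x * Real.exp x) h⟩

def beta (c : ℝ) : ℝ := c * Real.log c / (c - 1) - 1

def h (c : ℝ) : ℝ := 1 - 1 / beta c * lambertW (beta c * Real.exp (beta c) / c)

def ratio (c : ℝ) : ℝ := min ((c - 1) / (c * Real.log c)) (h c)

end OnlineMatching

end

noncomputable section

namespace OnlineMatching

open MeasureTheory Set

/-! ### A single machine -/

/-! What a machine does depends only on its own offset and on the jobs that the machines before it
reject, so the algorithm is a cascade (`runRev_cons`). Abel summation over the decreasing speeds
(`sum_mul_le_sum_mul_of_partial_sums`) removes the speeds: it suffices that, for each prefix of k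
machines, the expected sum of their largest jobs is at least `ratio c` times the sum of any k jobs
T.

This goes by induction on the machines (`ratio_mul_sum_le_integral_total`). If the first machine
accepts A, drop from T the jobs in A or, if there are none, the smallest job t of T. What is left
was rejected and needs one machine less. So it is enough to bound `ratio c` times the expected
dropped size by the expected largest job E[V] of this single machine (`ratio_mul_integral_loss_le`).

Let w be the largest job offered, r the earliest one above w/c, and a = log_c(w/r). Always V ≥ r,
and V is at least the lower end of the interval of w, which is w c^(y-1) with y uniform; hence E[V]
≥ r((c^a - 1)/ln c + 1 - a). If t > r, at most one job of T is accepted, so the loss is at most w,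
while E[V] ≥ w(c - 1)/(c ln c). If t ≤ r, the loss is at most V plus the accepted jobs that get
replaced, of expected size at most r(a + 1/(c-1)) (`integral_replaced_le`). The constant `h c` is
such that a tangent line of exp gives h(a + 1/(c-1)) ≤ (1-h)((c^a - 1)/ln c + 1 - a) for all a
(`h_mul_le`), that is, h E[loss] ≤ E[V]. -/

open Classical in
/-- The jobs that a machine with offset `x` accepts when it is offered the jobs in the list, the
latest job being the first one of the list. -/
def accepted (c x : ℝ) : List ℝ → List ℝ
  | [] => []
  | w :: p => if Accepts c x p w then w :: accepted c x p else accepted c x p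

open Classical in
/-- The jobs that a machine with offset `x` rejects when it is offered the jobs in the list, the
latest job being the first one of the list. -/
def rejected (c x : ℝ) : List ℝ → List ℝ
  | [] => []
  | w :: p => if Accepts c x p w then rejected c x p else w :: rejected c x p

theorem mem_of_mem_accepted {c x v : ℝ} {p : List ℝ} (hv : v ∈ accepted c x p) : v ∈ p := by
  induction p with
  | nil => simp [accepted] at hv
  | cons w p ih =>
    rw [accepted] at hv
    split_ifs at hv
    · rcases List.mem_cons.1 hv with rfl | h
      · simp
      · exact List.mem_cons_of_mem _ (ih h)
    · exact List.mem_cons_of_mem _ (ih hv)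

theorem coe_accepted_add_coe_rejected (c x : ℝ) (p : List ℝ) :
    (accepted c x p : Multiset ℝ) + (rejected c x p : Multiset ℝ) = p := by
  induction p with
  | nil => simp [accepted, rejected]
  | cons w p ih =>
    rw [accepted, rejected]
    split_ifs
    · rw [← Multiset.cons_coe, Multiset.cons_add, ih, Multiset.cons_coe]
    · rw [← Multiset.cons_coe, Multiset.add_cons, ih, Multiset.cons_coe]

theorem mem_of_mem_rejected {c x v : ℝ} {p : List ℝ} (hv : v ∈ rejected c x p) : v ∈ p := by
  have h : v ∈ (accepted c x p : Multiset ℝ) + (rejected c x p : Multiset ℝ) :=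
    Multiset.mem_add.2 (Or.inr (by simpa using hv))
  rwa [coe_accepted_add_coe_rejected, Multiset.mem_coe] at h

theorem exists_mem_accepted_index_ge {c x v : ℝ} {p : List ℝ} (hv : v ∈ p) :
    ∃ v' ∈ accepted c x p, intervalIndex c x v ≤ intervalIndex c x v' := by
  induction p generalizing v with
  | nil => simp at hv
  | cons w p ih =>
    rw [accepted]
    split_ifs with h
    · rcases List.mem_cons.1 hv with rfl | h'
      · exact ⟨v, by simp, le_rfl⟩
      · obtain ⟨v', h1, h2⟩ := ih h'
        exact ⟨v', List.mem_cons_of_mem _ h1, h2⟩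
    · rcases List.mem_cons.1 hv with rfl | h'
      · simp only [Accepts, not_forall, not_lt] at h
        obtain ⟨u, hu, hvu⟩ := h
        obtain ⟨v', h1, h2⟩ := ih hu
        exact ⟨v', h1, hvu.trans h2⟩
      · exact ih h'

/-- A rejected job never raises the largest interval index, so testing against all offered jobs, as
`accepted` does, is the same as the algorithm's test against the jobs held. -/
theorem accepts_accepted_iff {c x w : ℝ} {p : List ℝ} :
    Accepts c x (accepted c x p) w ↔ Accepts c x p w := by
  refine ⟨fun h v hv => ?_, fun h v hv => h v (mem_of_mem_accepted hv)⟩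
  obtain ⟨v', h1, h2⟩ := exists_mem_accepted_index_ge (c := c) (x := x) hv
  exact h2.trans_lt (h v' h1)

/-! ### Measurability in the offset -/

theorem measurable_intervalIndex (c w : ℝ) : Measurable fun x : ℝ => intervalIndex c x w := by
  unfold intervalIndex
  fun_prop

theorem measurableSet_accepts (c : ℝ) (p : List ℝ) (w : ℝ) :
    MeasurableSet {x : ℝ | Accepts c x p w} := by
  have : {x : ℝ | Accepts c x p w}
      = ⋂ v ∈ {v | v ∈ p}, {x | intervalIndex c x v < intervalIndex c x w} := by
    ext x; simp [Accepts]
  rw [this]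
  exact MeasurableSet.biInter (List.finite_toSet p).countable fun v _ =>
    measurableSet_lt (measurable_intervalIndex c v) (measurable_intervalIndex c w)

/-- The functional `G` is arbitrary so that the induction can absorb the newest job into it; no
measurable structure on lists is needed. -/
theorem measurable_accepted_rejected (c : ℝ) (p : List ℝ) (G : List ℝ → List ℝ → ℝ) :
    Measurable fun x => G (accepted c x p) (rejected c x p) := by
  classical
  induction p generalizing G with
  | nil => simp only [accepted, rejected, measurable_const]
  | cons w p ih =>
    have : (fun x => G (accepted c x (w :: p)) (rejected c x (w :: p))) = fun x =>
        if Accepts c x p w then G (w :: accepted c x p) (rejected c x p)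
        else G (accepted c x p) (w :: rejected c x p) := by
      funext x
      rw [accepted, rejected]
      split_ifs <;> rfl
    rw [this]
    exact Measurable.ite (measurableSet_accepts c p w) (ih fun a b => G (w :: a) b)
      (ih fun a b => G a (w :: b))

/-! ### The largest job and its interval -/

theorem maxSize_nil : maxSize [] = 0 := rfl

theorem maxSize_cons (w : ℝ) (p : List ℝ) : maxSize (w :: p) = max w (maxSize p) := rfl

theorem maxSize_nonneg (p : List ℝ) : 0 ≤ maxSize p := by
  induction p with
  | nil => exact le_rfl
  | cons w p ih => exact ih.trans (le_max_right _ _)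

theorem le_maxSize {p : List ℝ} {v : ℝ} (hv : v ∈ p) : v ≤ maxSize p := by
  induction p with
  | nil => simp at hv
  | cons w p ih =>
    rw [maxSize_cons]
    rcases List.mem_cons.1 hv with rfl | h
    · exact le_max_left _ _
    · exact (ih h).trans (le_max_right _ _)

theorem maxSize_le {p : List ℝ} {b : ℝ} (hb : 0 ≤ b) (h : ∀ v ∈ p, v ≤ b) : maxSize p ≤ b := by
  induction p with
  | nil => exact hb
  | cons w p ih =>
    exact max_le (h w (by simp)) (ih fun v hv => h v (List.mem_cons_of_mem _ hv))

theorem maxSize_mem {p : List ℝ} (hp : p ≠ []) (hpos : ∀ v ∈ p, 0 < v) : maxSize p ∈ p := by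
  induction p with
  | nil => exact absurd rfl hp
  | cons w p ih =>
    rw [maxSize_cons]
    rcases le_total (maxSize p) w with h | h
    · rw [max_eq_left h]; simp
    · rw [max_eq_right h]
      by_cases hp' : p = []
      · subst hp'
        exact absurd h (not_le.2 (hpos w (by simp)))
      · exact List.mem_cons_of_mem _ (ih hp' fun v hv => hpos v (List.mem_cons_of_mem _ hv))

theorem intervalIndex_mono {c x v w : ℝ} (hc : 1 < c) (hv : 0 < v) (hvw : v ≤ w) :
    intervalIndex c x v ≤ intervalIndex c x w := by
  unfold intervalIndex
  have : Real.logb c v ≤ Real.logb c w := Real.logb_le_logb_of_le hc hv hvw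
  gcongr

theorem accepts_iff_maxSize {c x w : ℝ} (hc : 1 < c) {p : List ℝ} (hp : p ≠ [])
    (hpos : ∀ v ∈ p, 0 < v) :
    Accepts c x p w ↔ intervalIndex c x (maxSize p) < intervalIndex c x w :=
  ⟨fun h => h _ (maxSize_mem hp hpos), fun h v hv =>
    (intervalIndex_mono hc (hpos v hv) (le_maxSize hv)).trans_lt h⟩

/-! ### Averages over a uniform offset -/

/-- `∫₀¹ g (fract (x - l)) dx = ∫₀¹ g`. -/
theorem integral_fract_sub (g : ℝ → ℝ) (l : ℝ) :
    ∫ x in (0 : ℝ)..1, g (Int.fract (x - l)) = ∫ x in (0 : ℝ)..1, g x := by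
  have hper : Function.Periodic (fun x : ℝ => g (Int.fract x)) 1 := fun x => by
    simp only [Int.fract_add_one]
  rw [intervalIntegral.integral_comp_sub_right (fun x => g (Int.fract x)) l]
  have := hper.intervalIntegral_add_eq (0 - l) 0
  rw [show (1 : ℝ) - l = 0 - l + 1 by ring, this, zero_add]
  rw [intervalIntegral.integral_of_le zero_le_one, intervalIntegral.integral_of_le zero_le_one,
    integral_Ioc_eq_integral_Ioo, integral_Ioc_eq_integral_Ioo]
  refine setIntegral_congr_fun measurableSet_Ioo fun x hx => ?_
  simp only [Int.fract_eq_self.2 ⟨hx.1.le, hx.2⟩]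

/-- The exponent of the lower end of the interval of `w` is `logb c w` minus a quantity that is
uniform when `x` is. -/
theorem intervalIndex_eq (c x w : ℝ) :
    (intervalIndex c x w : ℝ) + x = Real.logb c w + Int.fract (x - Real.logb c w) - 1 := by
  unfold intervalIndex
  rw [← neg_sub x, Int.ceil_neg, ← Int.self_sub_floor]
  push_cast
  ring

theorem intervalIntegrable_of_measurable_of_bound {f : ℝ → ℝ} (hf : Measurable f) {b : ℝ}
    (hb : ∀ x ∈ Ioc (0 : ℝ) 1, |f x| ≤ b) : IntervalIntegrable f volume 0 1 := by
  rw [intervalIntegrable_iff_integrableOn_Ioc_of_le zero_le_one]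
  exact Measure.integrableOn_of_bounded (by simp) hf.aestronglyMeasurable
    (ae_restrict_of_forall_mem measurableSet_Ioc fun x hx => by simpa using hb x hx)

theorem intervalIntegrable_fract (l : ℝ) :
    IntervalIntegrable (fun x => Int.fract (x - l)) volume 0 1 :=
  intervalIntegrable_of_measurable_of_bound (b := 1) (by fun_prop) fun x _ => by
    rw [abs_of_nonneg (Int.fract_nonneg _)]; exact (Int.fract_lt_one _).le

theorem intervalIntegrable_intervalIndex (c w : ℝ) :
    IntervalIntegrable (fun x => (intervalIndex c x w : ℝ)) volume 0 1 := by
  have : (fun x => (intervalIndex c x w : ℝ))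
      = fun x => Real.logb c w - 1 - x + Int.fract (x - Real.logb c w) := by
    funext x; linarith [intervalIndex_eq c x w]
  rw [this]
  exact (Continuous.intervalIntegrable (by fun_prop) _ _).add (intervalIntegrable_fract _)

/-- The mean index is exactly affine in the logarithm; probabilities below are bounded by dominating
indicators by differences of indices. -/
theorem integral_intervalIndex (c w : ℝ) :
    ∫ x in (0 : ℝ)..1, (intervalIndex c x w : ℝ) = Real.logb c w - 1 := by
  have : (fun x => (intervalIndex c x w : ℝ))
      = fun x => (Real.logb c w - 1 - x) + Int.fract (x - Real.logb c w) := by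
    funext x; linarith [intervalIndex_eq c x w]
  rw [this, intervalIntegral.integral_add (Continuous.intervalIntegrable (by fun_prop) _ _)
    (intervalIntegrable_fract _), integral_fract_sub (fun x => x),
    ← intervalIntegral.integral_add (Continuous.intervalIntegrable (by fun_prop) _ _)
      (Continuous.intervalIntegrable (by fun_prop) _ _)]
  simp

theorem sum_accepted_nonneg {c x : ℝ} {p : List ℝ} (hpos : ∀ v ∈ p, 0 < v) :
    0 ≤ (accepted c x p).sum :=
  List.sum_nonneg fun v hv => (hpos v (mem_of_mem_accepted hv)).le

theorem sum_accepted_le_sum {c x : ℝ} {p : List ℝ} (hpos : ∀ v ∈ p, 0 < v) :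
    (accepted c x p).sum ≤ p.sum := by
  have h := congrArg Multiset.sum (coe_accepted_add_coe_rejected c x p)
  rw [Multiset.sum_add, Multiset.sum_coe, Multiset.sum_coe, Multiset.sum_coe] at h
  have : 0 ≤ (rejected c x p).sum :=
    List.sum_nonneg fun v hv => (hpos v (mem_of_mem_rejected hv)).le
  linarith

theorem intervalIntegrable_sum_accepted (c : ℝ) {p : List ℝ} (hpos : ∀ v ∈ p, 0 < v) :
    IntervalIntegrable (fun x => (accepted c x p).sum) volume 0 1 :=
  intervalIntegrable_of_measurable_of_bound
    (measurable_accepted_rejected c p fun a _ => a.sum) fun x _ => by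
      rw [abs_of_nonneg (sum_accepted_nonneg hpos)]; exact sum_accepted_le_sum hpos

theorem maxSize_accepted_le {c x : ℝ} (p : List ℝ) : maxSize (accepted c x p) ≤ maxSize p :=
  maxSize_le (maxSize_nonneg p) fun _ hv => le_maxSize (mem_of_mem_accepted hv)

theorem intervalIntegrable_maxSize_accepted (c : ℝ) (p : List ℝ) :
    IntervalIntegrable (fun x => maxSize (accepted c x p)) volume 0 1 :=
  intervalIntegrable_of_measurable_of_bound
    (measurable_accepted_rejected c p fun a _ => maxSize a) fun x _ => by
      rw [abs_of_nonneg (maxSize_nonneg _)]; exact maxSize_accepted_le p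

theorem intervalIntegrable_ite {P : ℝ → Prop} [DecidablePred P] (hP : MeasurableSet {x | P x}) (r : ℝ) :
    IntervalIntegrable (fun x => if P x then r else 0) volume 0 1 :=
  intervalIntegrable_of_measurable_of_bound (b := |r|)
    (Measurable.ite hP measurable_const measurable_const) fun x _ => by split_ifs <;> simp

theorem measurableSet_index_lt (c v w : ℝ) :
    MeasurableSet {x | intervalIndex c x v < intervalIndex c x w} :=
  measurableSet_lt (measurable_intervalIndex c v) (measurable_intervalIndex c w)

theorem integral_ite_le_one {P : ℝ → Prop} [DecidablePred P] (hP : MeasurableSet {x | P x}) :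
    ∫ x in (0 : ℝ)..1, (if P x then (1 : ℝ) else 0) ≤ 1 := by
  have := intervalIntegral.integral_mono_on zero_le_one (intervalIntegrable_ite hP 1)
    (intervalIntegrable_const (c := (1 : ℝ)))
    (fun x _ => by split_ifs <;> simp)
  simpa using this

open Classical in
theorem integral_index_lt_le {c v w : ℝ} (hc : 1 < c) (hv : 0 < v) (hvw : v ≤ w) :
    ∫ x in (0 : ℝ)..1, (if intervalIndex c x v < intervalIndex c x w then (1 : ℝ) else 0)
      ≤ Real.logb c w - Real.logb c v := by
  have := intervalIntegral.integral_mono_on zero_le_one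
    (intervalIntegrable_ite (measurableSet_index_lt c v w) 1)
    ((intervalIntegrable_intervalIndex c w).sub (intervalIntegrable_intervalIndex c v))
    (fun x _ => by
      have h1 := intervalIndex_mono (x := x) hc hv hvw
      split_ifs with h
      · have : intervalIndex c x v + 1 ≤ intervalIndex c x w := h
        have : (intervalIndex c x v : ℝ) + 1 ≤ intervalIndex c x w := by exact_mod_cast this
        linarith
      · have : (intervalIndex c x v : ℝ) ≤ intervalIndex c x w := by exact_mod_cast h1
        linarith)
  rw [intervalIntegral.integral_sub (intervalIntegrable_intervalIndex c w)
    (intervalIntegrable_intervalIndex c v), integral_intervalIndex, integral_intervalIndex] at this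
  exact this.trans (by linarith)

theorem intervalIndex_div {c x w : ℝ} (hc : 1 < c) (hw : 0 < w) :
    intervalIndex c x (w / c) = intervalIndex c x w - 1 := by
  unfold intervalIndex
  rw [Real.logb_div hw.ne' (by positivity), Real.logb_self_eq_one hc,
    show Real.logb c w - 1 - x = Real.logb c w - x - 1 by ring, Int.ceil_sub_one]

open Classical in
/-- If `v` is at most `w / c`, the probability that `u` lies strictly between `v` and `w` in terms
of intervals is at most `log_c (w / v) - 1`. -/
theorem integral_index_lt_lt_le {c u v w : ℝ} (hc : 1 < c) (hv : 0 < v) (hw : 0 < w)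
    (hvw : v ≤ w / c) :
    ∫ x in (0 : ℝ)..1, (if intervalIndex c x v < intervalIndex c x u ∧
        intervalIndex c x u < intervalIndex c x w then (1 : ℝ) else 0)
      ≤ Real.logb c w - Real.logb c v - 1 := by
  have hms : MeasurableSet {x | intervalIndex c x v < intervalIndex c x u ∧
      intervalIndex c x u < intervalIndex c x w} :=
    (measurableSet_index_lt c v u).inter (measurableSet_index_lt c u w)
  have := intervalIntegral.integral_mono_on zero_le_one
    (intervalIntegrable_ite hms 1)
    (((intervalIntegrable_intervalIndex c w).sub (intervalIntegrable_intervalIndex c v)).sub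
      (intervalIntegrable_const (c := (1 : ℝ))))
    (fun x _ => by
      -- Two strict jumps make the index difference at least 2, and `v ≤ w / c` makes it at least 1
      -- always, so the indicator is at most the difference minus 1.
      have h1 := intervalIndex_mono (x := x) hc hv hvw
      rw [intervalIndex_div hc hw] at h1
      show (if intervalIndex c x v < intervalIndex c x u ∧
        intervalIndex c x u < intervalIndex c x w then (1 : ℝ) else 0) ≤
          (intervalIndex c x w : ℝ) - intervalIndex c x v - 1
      split_ifs with h
      · have : intervalIndex c x v + 2 ≤ intervalIndex c x w := by omega
        have : (intervalIndex c x v : ℝ) + 2 ≤ intervalIndex c x w := by exact_mod_cast this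
        linarith
      · have : (intervalIndex c x v : ℝ) ≤ intervalIndex c x w - 1 := by exact_mod_cast h1
        linarith)
  rw [intervalIntegral.integral_sub ((intervalIntegrable_intervalIndex c w).sub
    (intervalIntegrable_intervalIndex c v)) intervalIntegrable_const,
    intervalIntegral.integral_sub (intervalIntegrable_intervalIndex c w)
    (intervalIntegrable_intervalIndex c v), integral_intervalIndex, integral_intervalIndex] at this
  simp only [intervalIntegral.integral_const, smul_eq_mul, sub_zero, one_mul] at this
  exact this.trans (by linarith)

/-! ### Expected total size of the accepted jobs -/

theorem rpow_logb_div {c v w : ℝ} (hc : 1 < c) (hv : 0 < v) (hw : 0 < w) :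
    c ^ (Real.logb c w - Real.logb c v) = w / v := by
  rw [← Real.logb_div hw.ne' hv.ne', Real.rpow_logb (by positivity) hc.ne' (by positivity)]

/-- One step of the induction in `integral_sum_accepted_le`, when the maximum rises from `v` to `w`.
With g = log_c(w/v) ≤ 1, Bernoulli gives v/w = c^(-g) ≤ 1 - g(1 - 1/c); for g ≥ 1 the probability is
capped at 1. -/
theorem min_logb_mul_add_le {c v w : ℝ} (hc : 1 < c) (hv : 0 < v) (hvw : v ≤ w) :
    w * min 1 (Real.logb c w - Real.logb c v) + c / (c - 1) * v ≤ c / (c - 1) * w := by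
  have hc1 : 0 < c - 1 := by linarith
  have hw : 0 < w := hv.trans_le hvw
  rcases le_total (c * v) w with h | h
  · have h1 : w * min 1 (Real.logb c w - Real.logb c v) ≤ w * 1 := by
      gcongr; exact min_le_left _ _
    have h2 : c / (c - 1) * v ≤ 1 / (c - 1) * w := by
      rw [div_mul_eq_mul_div, div_mul_eq_mul_div, one_mul]; gcongr
    have h3 : c / (c - 1) * w = w + 1 / (c - 1) * w := by field_simp; ring
    linarith
  · set g := Real.logb c w - Real.logb c v with hg
    have hg0 : 0 ≤ g := sub_nonneg.2 (Real.logb_le_logb_of_le hc hv hvw)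
    have hcg : c ^ g = w / v := rpow_logb_div hc hv hw
    have hg1 : g ≤ 1 := by
      have : c ^ g ≤ c ^ (1 : ℝ) := by
        rw [hcg, Real.rpow_one, div_le_iff₀ hv]; exact h
      exact (Real.rpow_le_rpow_left_iff hc).1 this
    have hb := rpow_one_add_le_one_add_mul_self (s := c⁻¹ - 1) (p := g)
      (by have : 0 < c⁻¹ := by positivity
          linarith) hg0 hg1
    rw [add_sub_cancel, Real.inv_rpow (by positivity), hcg, inv_div] at hb
    have hv' : v ≤ w * (1 + g * (c⁻¹ - 1)) := by
      rwa [div_le_iff₀ hw, mul_comm] at hb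
    have : c / (c - 1) * v ≤ c / (c - 1) * (w * (1 + g * (c⁻¹ - 1))) := by gcongr
    have h3 : c / (c - 1) * (w * (1 + g * (c⁻¹ - 1))) = c / (c - 1) * w - w * g := by
      field_simp; ring
    rw [min_eq_right hg1]
    linarith

/-- The right side is a potential: only a new maximum can be accepted, and the rise of the potential
pays for its size times the acceptance probability. -/
theorem integral_sum_accepted_le {c : ℝ} (hc : 1 < c) {p : List ℝ} (hpos : ∀ v ∈ p, 0 < v) :
    ∫ x in (0 : ℝ)..1, (accepted c x p).sum ≤ c / (c - 1) * maxSize p := by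
  classical
  have hc1 : 0 < c - 1 := by linarith
  induction p with
  | nil => simp [accepted, maxSize_nil]
  | cons w p ih =>
    have hpos' : ∀ v ∈ p, 0 < v := fun v hv => hpos v (List.mem_cons_of_mem _ hv)
    have hw : 0 < w := hpos w (by simp)
    have hK : 0 ≤ c / (c - 1) := by positivity
    have ih := ih hpos'
    have hint : ∫ x in (0 : ℝ)..1, (accepted c x (w :: p)).sum
        = (∫ x in (0 : ℝ)..1, (accepted c x p).sum)
          + w * ∫ x in (0 : ℝ)..1, (if Accepts c x p w then (1 : ℝ) else 0) := by
      rw [← intervalIntegral.integral_const_mul, ← intervalIntegral.integral_add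
        (intervalIntegrable_sum_accepted c hpos')
        ((intervalIntegrable_ite (measurableSet_accepts c p w) 1).const_mul w)]
      congr 1
      funext x
      rw [accepted]
      split_ifs
      · simp [add_comm]
      · simp
    rw [hint, maxSize_cons]
    by_cases hp : p = []
    · subst hp
      have h1 := integral_ite_le_one (measurableSet_accepts c [] w)
      have h2 : w * ∫ x in (0 : ℝ)..1, (if Accepts c x [] w then (1 : ℝ) else 0) ≤ w * 1 := by
        gcongr
      have h3 : w ≤ c / (c - 1) * w := by
        have : 1 ≤ c / (c - 1) := by rw [le_div_iff₀ hc1]; linarith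
        nlinarith
      simp only [maxSize_nil, max_eq_left hw.le]
      simp only [maxSize_nil, mul_zero] at ih
      linarith
    rcases le_total w (maxSize p) with h | h
    · rw [max_eq_right h]
      have : ∀ x, ¬ Accepts c x p w := fun x hx => by
        rw [accepts_iff_maxSize hc hp hpos'] at hx
        exact absurd (intervalIndex_mono hc hw h) (not_le.2 hx)
      simpa [this] using ih
    · rw [max_eq_left h]
      have hm : 0 < maxSize p := hpos' _ (maxSize_mem hp hpos')
      have h1 := integral_ite_le_one (measurableSet_accepts c p w)
      have h2 : ∫ x in (0 : ℝ)..1, (if Accepts c x p w then (1 : ℝ) else 0)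
          ≤ Real.logb c w - Real.logb c (maxSize p) := by
        simp only [accepts_iff_maxSize hc hp hpos']
        exact integral_index_lt_le hc hm h
      have h3 : w * ∫ x in (0 : ℝ)..1, (if Accepts c x p w then (1 : ℝ) else 0)
          ≤ w * min 1 (Real.logb c w - Real.logb c (maxSize p)) := by
        gcongr; exact le_min h1 h2
      linarith [min_logb_mul_add_le hc hm h]

open Classical in
/-- Bound on the expected total size of the jobs that a machine accepts and later replaces: `p` are
the jobs offered before `r`, the first job above `w / c`, where `w` is the largest job. -/
theorem integral_replaced_le {c r w : ℝ} (hc : 1 < c) {p : List ℝ} (hpos : ∀ v ∈ p, 0 < v)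
    (hp : ∀ v ∈ p, v ≤ w / c) (hr : w / c < r) (hrw : r ≤ w) (hw : 0 < w) :
    ∫ x in (0 : ℝ)..1, ((accepted c x p).sum +
        if Accepts c x p r ∧ intervalIndex c x r < intervalIndex c x w then r else 0)
      ≤ r * (Real.logb c w - Real.logb c r + 1 / (c - 1)) := by
  have hc1 : 0 < c - 1 := by linarith
  have hr0 : 0 < r := lt_trans (by positivity) hr
  have hms : MeasurableSet {x | Accepts c x p r ∧ intervalIndex c x r < intervalIndex c x w} :=
    (measurableSet_accepts c p r).inter (measurableSet_index_lt c r w)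
  have hint : ∫ x in (0 : ℝ)..1, ((accepted c x p).sum +
        if Accepts c x p r ∧ intervalIndex c x r < intervalIndex c x w then r else 0)
      = (∫ x in (0 : ℝ)..1, (accepted c x p).sum) + r * ∫ x in (0 : ℝ)..1,
        (if Accepts c x p r ∧ intervalIndex c x r < intervalIndex c x w then (1 : ℝ) else 0) := by
    rw [← intervalIntegral.integral_const_mul, ← intervalIntegral.integral_add
      (intervalIntegrable_sum_accepted c hpos) ((intervalIntegrable_ite hms 1).const_mul r)]
    simp only [mul_ite, mul_one, mul_zero]
  have hA : ∫ x in (0 : ℝ)..1,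
        (if Accepts c x p r ∧ intervalIndex c x r < intervalIndex c x w then (1 : ℝ) else 0)
        ≤ Real.logb c w - Real.logb c r := by
    refine le_trans (intervalIntegral.integral_mono_on zero_le_one (intervalIntegrable_ite hms 1)
      (intervalIntegrable_ite (measurableSet_index_lt c r w) 1) fun x _ => ?_)
      (integral_index_lt_le hc hr0 hrw)
    by_cases h : intervalIndex c x r < intervalIndex c x w
    · rw [if_pos h]; split_ifs <;> simp
    · rw [if_neg (fun h' => h h'.2), if_neg h]
  set P := ∫ x in (0 : ℝ)..1,
        (if Accepts c x p r ∧ intervalIndex c x r < intervalIndex c x w then (1 : ℝ) else 0) with hP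
  set A := Real.logb c w - Real.logb c r with hAdef
  rw [hint]
  by_cases hpn : p = []
  · subst hpn
    have : 0 ≤ r * (1 / (c - 1)) := by positivity
    have := mul_le_mul_of_nonneg_left hA hr0.le
    simp only [accepted, List.sum_nil, intervalIntegral.integral_zero, zero_add, mul_add]
    linarith
  set m := maxSize p with hmdef
  have hmp : m ∈ p := maxSize_mem hpn hpos
  have hm : 0 < m := hpos m hmp
  have hmw : m ≤ w / c := hp m hmp
  have hB : P ≤ Real.logb c w - Real.logb c m - 1 := by
    rw [hP]
    simp only [accepts_iff_maxSize hc hpn hpos]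
    exact integral_index_lt_lt_le hc hm hw hmw
  have hS := integral_sum_accepted_le hc hpos
  rw [← hmdef] at hS
  -- Here g = log_c(cm/r) is the excess of the bound `hA` on P over the bound `hB`. If g ≤ 0, then m
  -- ≤ r/c and `hA` suffices. If g ≥ 0, then P ≤ A - g, and by Bernoulli c^g ≤ 1 + g(c-1) the saving
  -- r g pays for what p adds beyond r/(c-1).
  set g := A + 1 - (Real.logb c w - Real.logb c m) with hg
  rcases le_total g 0 with h0 | h0
  · have : m ≤ r / c := by
      have h1 : Real.logb c m ≤ Real.logb c (r / c) := by
        rw [Real.logb_div hr0.ne' (by positivity), Real.logb_self_eq_one hc]; linarith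
      exact (Real.logb_le_logb hc hm (by positivity)).1 h1
    have h2 : c / (c - 1) * m ≤ c / (c - 1) * (r / c) := by gcongr
    have h3 : c / (c - 1) * (r / c) = r * (1 / (c - 1)) := by field_simp
    have := mul_le_mul_of_nonneg_left hA hr0.le
    rw [mul_add]; linarith
  · have hA1 : Real.logb c m ≤ Real.logb c w - 1 := by
      have := Real.logb_le_logb_of_le hc hm hmw
      rwa [Real.logb_div hw.ne' (by positivity), Real.logb_self_eq_one hc] at this
    have hg1 : g ≤ 1 := by
      have : Real.logb c w - 1 ≤ Real.logb c r := by
        have := Real.logb_le_logb_of_le hc (by positivity) hr.le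
        rwa [Real.logb_div hw.ne' (by positivity), Real.logb_self_eq_one hc] at this
      linarith
    have hb := rpow_one_add_le_one_add_mul_self (s := c - 1) (p := g) (by linarith) h0 hg1
    have hcg : c ^ g = m * c / r := by
      rw [show g = Real.logb c (m * c) - Real.logb c r by
        rw [Real.logb_mul hm.ne' (by positivity), Real.logb_self_eq_one hc]; ring,
        rpow_logb_div hc hr0 (by positivity)]
    rw [add_sub_cancel, hcg, div_le_iff₀ hr0] at hb
    have h1 : c / (c - 1) * m ≤ r * (1 / (c - 1)) + r * g := by
      rw [div_mul_eq_mul_div, div_le_iff₀ hc1]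
      have : (r * (1 / (c - 1)) + r * g) * (c - 1) = (1 + g * (c - 1)) * r := by
        field_simp
      linarith
    have h2 : r * P ≤ r * (A - g) := by
      gcongr; linarith
    have : r * (A + 1 / (c - 1)) = r * (A - g) + (r * (1 / (c - 1)) + r * g) := by ring
    linarith

/-! ### The ratio -/

theorem beta_pos {c : ℝ} (hc : 1 < c) : 0 < beta c := by
  have hc0 : 0 < c := by linarith
  have h := Real.log_lt_sub_one_of_pos (inv_pos.2 hc0) (by
    intro h; rw [inv_eq_one] at h; linarith)
  rw [Real.log_inv] at h
  have h2 : c - 1 < c * Real.log c := by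
    have := mul_lt_mul_of_pos_left h hc0
    rw [mul_sub, mul_inv_cancel₀ hc0.ne'] at this
    linarith
  rw [beta, sub_pos, lt_div_iff₀ (by linarith)]
  linarith

/-- This fixed-point equation is all that the sequel uses about the Lambert function. -/
theorem one_sub_h_eq {c : ℝ} (hc : 1 < c) : 1 - h c = Real.exp (beta c * h c) / c := by
  have hb := beta_pos hc
  have hc0 : 0 < c := by linarith
  have hy : 0 ≤ beta c * Real.exp (beta c) / c := by positivity
  have hz := (lambertW_spec hy).2
  set z := lambertW (beta c * Real.exp (beta c) / c) with hzdef
  have hh : h c = 1 - 1 / beta c * z := rfl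
  have h1 : beta c * h c = beta c - z := by rw [hh]; field_simp
  rw [h1, Real.exp_sub, hh]
  have : Real.exp z ≠ 0 := (Real.exp_pos z).ne'
  field_simp at hz ⊢
  linarith

theorem h_nonneg {c : ℝ} (hc : 1 < c) : 0 ≤ h c := by
  by_contra! hneg
  have h1 := one_sub_h_eq hc
  have h2 : Real.exp (beta c * h c) ≤ 1 :=
    Real.exp_le_one_iff.2 (mul_nonpos_of_nonneg_of_nonpos (beta_pos hc).le hneg.le)
  have h3 : Real.exp (beta c * h c) / c ≤ 1 := by
    rw [div_le_one (by linarith)]; linarith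
  linarith

theorem h_mul_le {c : ℝ} (hc : 1 < c) (a : ℝ) :
    h c * (a + 1 / (c - 1)) ≤ (1 - h c) * ((c ^ a - 1) / Real.log c + 1 - a) := by
  have hl := Real.log_pos hc
  have hc0 : 0 < c := by linarith
  have hc1 : 0 < c - 1 := by linarith
  have h1 : (1 - h c) * c ^ a = Real.exp (beta c * h c + Real.log c * a - Real.log c) := by
    rw [one_sub_h_eq hc, Real.rpow_def_of_pos hc0, Real.exp_sub, Real.exp_add, Real.exp_log hc0]
    ring
  have h2 : beta c * h c + Real.log c * a - Real.log c + 1 ≤ (1 - h c) * c ^ a := by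
    rw [h1]; exact Real.add_one_le_exp _
  have h3 : (beta c * h c + Real.log c * a - Real.log c + 1) / Real.log c
      ≤ (1 - h c) * c ^ a / Real.log c := by gcongr
  have h4 : (1 - h c) * ((c ^ a - 1) / Real.log c + 1 - a)
      = (1 - h c) * c ^ a / Real.log c - (1 - h c) / Real.log c + (1 - h c) * (1 - a) := by
    field_simp; ring
  have h5 : (beta c * h c + Real.log c * a - Real.log c + 1) / Real.log c
      - (1 - h c) / Real.log c + (1 - h c) * (1 - a) = h c * (a + 1 / (c - 1)) := by
    rw [beta]; field_simp; ring
  linarith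

/-! ### The value of a single machine -/

theorem integral_rpow_sub_one {c : ℝ} (hc : 1 < c) (b : ℝ) :
    ∫ y in b..1, c ^ (y - 1) = (1 - c ^ (b - 1)) / Real.log c := by
  have hc0 : 0 < c := by linarith
  have hl := Real.log_pos hc
  have hd : ∀ y ∈ uIcc b 1, HasDerivAt (fun y => c ^ (y - 1) / Real.log c) (c ^ (y - 1)) y := by
    intro y _
    have := (((hasDerivAt_id y).sub_const 1).const_rpow hc0).div_const (Real.log c)
    refine this.congr_deriv ?_
    simp only [id_eq, mul_one]
    exact mul_div_cancel_left₀ _ hl.ne'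
  rw [intervalIntegral.integral_eq_sub_of_hasDerivAt hd]
  · simp; ring
  · exact Continuous.intervalIntegrable
      (Continuous.rpow continuous_const (by fun_prop) fun y => Or.inl hc0.ne') _ _

/-- The two terms of the maximum cross at y = 1 - a. -/
theorem le_integral_max_rpow {c a : ℝ} (hc : 1 < c) (ha : 0 ≤ a) (ha1 : a ≤ 1) :
    (1 - a) * c ^ (-a) + (1 - c ^ (-a)) / Real.log c
      ≤ ∫ y in (0 : ℝ)..1, max (c ^ (-a)) (c ^ (y - 1)) := by
  have hc0 : 0 < c := by linarith
  have hcont : Continuous fun y : ℝ => c ^ (y - 1) :=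
    Continuous.rpow continuous_const (by fun_prop) fun y => Or.inl hc0.ne'
  have hcm : Continuous fun y : ℝ => max (c ^ (-a)) (c ^ (y - 1)) := continuous_const.max hcont
  rw [← intervalIntegral.integral_add_adjacent_intervals (b := 1 - a)
    (hcm.intervalIntegrable _ _) (hcm.intervalIntegrable _ _)]
  have h1 := intervalIntegral.integral_mono_on (a := 0) (b := 1 - a) (by linarith)
    (intervalIntegrable_const (c := c ^ (-a)) (μ := volume)) (hcm.intervalIntegrable _ _)
    (fun y _ => le_max_left _ _)
  have h2 := intervalIntegral.integral_mono_on (a := 1 - a) (b := 1) (by linarith)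
    (hcont.intervalIntegrable (μ := volume) _ _) (hcm.intervalIntegrable _ _)
    (fun y _ => le_max_right _ _)
  rw [integral_rpow_sub_one hc, show 1 - a - 1 = -a by ring] at h2
  simp only [intervalIntegral.integral_const, smul_eq_mul, sub_zero] at h1
  linarith

/-- As lists are latest first, `r` is the earliest job with `P`, and `p₀` holds the jobs before it.
-/
theorem exists_append_of_exists_mem {P : ℝ → Prop} {p : List ℝ} (hp : ∃ v ∈ p, P v) :
    ∃ q r p₀, p = q ++ r :: p₀ ∧ P r ∧ ∀ v ∈ p₀, ¬ P v := by
  induction p with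
  | nil => simp at hp
  | cons w p ih =>
    by_cases h : ∃ v ∈ p, P v
    · obtain ⟨q, r, p₀, rfl, h1, h2⟩ := ih h
      exact ⟨w :: q, r, p₀, rfl, h1, h2⟩
    · obtain ⟨v, hv, hPv⟩ := hp
      rcases List.mem_cons.1 hv with rfl | h'
      · exact ⟨[], v, p, rfl, hPv, fun u hu hPu => h ⟨u, hu, hPu⟩⟩
      · exact absurd ⟨v, h', hPv⟩ h

/-- After a job `r > w / c` has been offered, at most one further job of size at most `w` is
accepted, and none if `r` and `w` are in the same interval. -/
theorem accepted_append {c x r w : ℝ} (hc : 1 < c) (hw : 0 < w) (hr : w / c < r)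
    (q p₀ : List ℝ) (hq : ∀ v ∈ q, 0 < v ∧ v ≤ w) :
    accepted c x (q ++ r :: p₀) = accepted c x (r :: p₀) ∨
      ∃ b ∈ q, intervalIndex c x r < intervalIndex c x w ∧
        intervalIndex c x b = intervalIndex c x w ∧
        accepted c x (q ++ r :: p₀) = b :: accepted c x (r :: p₀) := by
  -- The job `r` is at most one interval below `w`, so a job accepted after it lands in the interval
  -- of `w` and blocks all later ones.
  have hidx : intervalIndex c x w - 1 ≤ intervalIndex c x r := by
    rw [← intervalIndex_div hc hw]
    exact intervalIndex_mono hc (by positivity) hr.le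
  induction q with
  | nil => exact Or.inl rfl
  | cons v q ih =>
    have ih := ih fun u hu => hq u (List.mem_cons_of_mem _ hu)
    rw [List.cons_append, accepted]
    split_ifs with hacc
    · have hv := hq v (by simp)
      have h1 : intervalIndex c x v ≤ intervalIndex c x w := intervalIndex_mono hc hv.1 hv.2
      have h2 : intervalIndex c x r < intervalIndex c x v := hacc r (by simp)
      rcases ih with h | ⟨b, hb, -, hbw, -⟩
      · exact Or.inr ⟨v, by simp, by omega, by omega, by rw [h]⟩
      · have := hacc b (by simp [hb])
        omega
    · rcases ih with h | ⟨b, hb, h⟩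
      · exact Or.inl h
      · exact Or.inr ⟨b, List.mem_cons_of_mem _ hb, h⟩

theorem rpow_index_lt {c x w : ℝ} (hc : 1 < c) (hw : 0 < w) :
    c ^ ((intervalIndex c x w : ℝ) + x) < w := ((mem_interval_iff hc hw _).2 rfl).1

/-- The largest accepted job is at least as large as the lower end of the interval of the largest
job. -/
theorem mul_rpow_fract_le_maxSize_accepted {c x w : ℝ} (hc : 1 < c) {p : List ℝ}
    (hpos : ∀ v ∈ p, 0 < v) (hw : w ∈ p) :
    w * c ^ (Int.fract (x - Real.logb c w) - 1) ≤ maxSize (accepted c x p) := by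
  have hc0 : 0 < c := by linarith
  obtain ⟨v, hv, hidx⟩ := exists_mem_accepted_index_ge (c := c) (x := x) hw
  refine le_trans ?_ (le_maxSize hv)
  have h1 := (rpow_index_lt (x := x) hc (hpos v (mem_of_mem_accepted hv))).le
  refine le_trans ?_ h1
  have h2 : c ^ ((intervalIndex c x w : ℝ) + x) ≤ c ^ ((intervalIndex c x v : ℝ) + x) := by
    gcongr
    · exact hc.le
  refine le_trans (le_of_eq ?_) h2
  rw [intervalIndex_eq, add_sub_assoc, Real.rpow_add hc0,
    Real.rpow_logb hc0 hc.ne' (hpos w hw)]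

/-- If `w` lies in a higher interval than `r`, some accepted job reaches that interval and exceeds
`r`. Otherwise `r` itself is accepted, because every job of `p₀` is at least one interval below `w`.
-/
theorem le_maxSize_accepted_append {c x r w : ℝ} (hc : 1 < c) {q p₀ : List ℝ}
    (hpos : ∀ v ∈ q ++ r :: p₀, 0 < v) (hle : ∀ v ∈ q, v ≤ w) (hw : w ∈ q ++ r :: p₀)
    (hr : w / c < r) (hp₀ : ∀ v ∈ p₀, v ≤ w / c) :
    r ≤ maxSize (accepted c x (q ++ r :: p₀)) := by
  have hw0 : 0 < w := hpos w hw
  by_cases hidx : intervalIndex c x r < intervalIndex c x w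
  · obtain ⟨v, hv, hwv⟩ := exists_mem_accepted_index_ge (c := c) (x := x) hw
    refine le_trans ?_ (le_maxSize hv)
    by_contra! hvr
    have := intervalIndex_mono (x := x) hc (hpos v (mem_of_mem_accepted hv)) hvr.le
    omega
  · rcases accepted_append (x := x) hc hw0 hr q p₀
      (fun v hv => ⟨hpos v (by simp [hv]), hle v hv⟩) with h | ⟨b, hb, hrw', -⟩
    · have hacc : Accepts c x p₀ r := fun v hv => by
        have h0 := intervalIndex_mono (x := x) hc (hpos v (by simp [hv])) (hp₀ v hv)
        rw [intervalIndex_div hc hw0] at h0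
        omega
      rw [h, accepted, if_pos hacc]
      exact le_maxSize (by simp)
    · exact absurd hrw' hidx

/-! ### The loss of the comparison solution -/

/-- `T.sum - (remaining T t A).sum` is what the comparison solution `T` loses when the jobs `A` are
no longer available and it may use one machine less. -/
def remaining (T : Multiset ℝ) (t : ℝ) (A : List ℝ) : Multiset ℝ :=
  if T ∩ (A : Multiset ℝ) = 0 then T.erase t else T - (A : Multiset ℝ)

theorem card_remaining_lt {T : Multiset ℝ} {t : ℝ} (ht : t ∈ T) (A : List ℝ) :
    (remaining T t A).card < T.card := by
  unfold remaining
  split_ifs with h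
  · exact Multiset.card_erase_lt_of_mem ht
  · have h1 := congrArg Multiset.card (Multiset.sub_add_inter T (A : Multiset ℝ))
    rw [Multiset.card_add] at h1
    have h2 : 0 < (T ∩ (A : Multiset ℝ)).card := Multiset.card_pos.2 h
    omega

theorem remaining_le_rejected {c x : ℝ} {p : List ℝ} {T : Multiset ℝ} (hT : T ≤ p) (t : ℝ) :
    remaining T t (accepted c x p) ≤ (rejected c x p : Multiset ℝ) := by
  have h1 : T - (accepted c x p : Multiset ℝ) ≤ (rejected c x p : Multiset ℝ) := by
    rw [Multiset.sub_le_iff_le_add, add_comm, coe_accepted_add_coe_rejected]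
    exact hT
  unfold remaining
  split_ifs with h
  · have h2 := Multiset.sub_add_inter T (accepted c x p : Multiset ℝ)
    rw [h, add_zero] at h2
    rw [h2] at h1
    exact (Multiset.erase_le t T).trans h1
  · exact h1

theorem sum_sub_sum_remaining {T : Multiset ℝ} {t : ℝ} (ht : t ∈ T) (A : List ℝ) :
    T.sum - (remaining T t A).sum
      = if T ∩ (A : Multiset ℝ) = 0 then t else (T ∩ (A : Multiset ℝ)).sum := by
  unfold remaining
  split_ifs with h
  · have := congrArg Multiset.sum (Multiset.cons_erase ht)
    rw [Multiset.sum_cons] at this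
    linarith
  · have := congrArg Multiset.sum (Multiset.sub_add_inter T (A : Multiset ℝ))
    rw [Multiset.sum_add] at this
    linarith

theorem multiset_sum_le_sum_of_le {S T : Multiset ℝ} (h : S ≤ T) (hT : ∀ v ∈ T, 0 ≤ v) :
    S.sum ≤ T.sum := by
  obtain ⟨U, rfl⟩ := Multiset.le_iff_exists_add.1 h
  rw [Multiset.sum_add]
  have : 0 ≤ U.sum := Multiset.sum_nonneg fun v hv => hT v (Multiset.mem_add.2 (Or.inr hv))
  linarith

theorem multiset_inter_append_le {T : Multiset ℝ} {B C : List ℝ} (h : ∀ v ∈ C, v ∉ T) :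
    T ∩ ((B ++ C : List ℝ) : Multiset ℝ) ≤ (B : Multiset ℝ) := by
  rw [Multiset.le_iff_count]
  intro v
  rw [Multiset.count_inter, Multiset.coe_count, Multiset.coe_count, List.count_append]
  by_cases hv : v ∈ C
  · rw [Multiset.count_eq_zero_of_notMem (h v hv)]; simp
  · rw [List.count_eq_zero_of_not_mem hv]; simp

/-- The expected loss of the comparison solution is at most `1 / ratio c` times the expected value
of the machine. -/
theorem ratio_mul_integral_loss_le {c : ℝ} (hc : 1 < c) {p : List ℝ} (hpos : ∀ v ∈ p, 0 < v)
    {T : Multiset ℝ} (hT : T ≤ p) {t : ℝ} (ht : t ∈ T) (htmin : ∀ v ∈ T, t ≤ v) :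
    ratio c * ∫ x in (0 : ℝ)..1, (T.sum - (remaining T t (accepted c x p)).sum)
      ≤ ∫ x in (0 : ℝ)..1, maxSize (accepted c x p) := by
  classical
  have hc0 : 0 < c := by linarith
  have hl := Real.log_pos hc
  have hTp : ∀ v ∈ T, v ∈ p := fun v hv => by simpa using Multiset.mem_of_le hT hv
  have hpn : p ≠ [] := by
    rintro rfl; simpa using hTp t ht
  set w := maxSize p with hwdef
  have hwp : w ∈ p := maxSize_mem hpn hpos
  have hw : 0 < w := hpos w hwp
  have hle : ∀ v ∈ p, v ≤ w := fun v hv => le_maxSize hv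
  obtain ⟨q, r, p₀, hpq, hr, hp₀⟩ := exists_append_of_exists_mem (P := fun v => w / c < v)
    ⟨w, hwp, div_lt_self hw hc⟩
  simp only [not_lt] at hp₀
  have hrp : r ∈ p := by rw [hpq]; simp
  have hr0 : 0 < r := hpos r hrp
  have hrw : r ≤ w := hle r hrp
  have hposq := hpos
  have hwq := hwp
  rw [hpq] at hposq hwq
  have hp₀pos : ∀ v ∈ p₀, 0 < v := fun v hv => hposq v (by simp [hv])
  have hleq : ∀ v ∈ q, v ≤ w := fun v hv => hle v (by rw [hpq]; simp [hv])
  have happ : ∀ x, _ := fun x => accepted_append (x := x) hc hw hr q p₀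
    (fun v hv => ⟨hposq v (by simp [hv]), hleq v hv⟩)
  have hVr : ∀ x, r ≤ maxSize (accepted c x p) := fun x => by
    rw [hpq]; exact le_maxSize_accepted_append hc hposq hleq hwq hr hp₀
  have hVint := intervalIntegrable_maxSize_accepted c p
  have hmeas : Measurable fun x => T.sum - (remaining T t (accepted c x p)).sum :=
    measurable_accepted_rejected c p fun a _ => T.sum - (remaining T t a).sum
  have hLnn : ∀ x, 0 ≤ T.sum - (remaining T t (accepted c x p)).sum := fun x => by
    rw [sum_sub_sum_remaining ht]
    split_ifs
    · exact (hpos t (hTp t ht)).le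
    · exact Multiset.sum_nonneg fun v hv =>
        (hpos v (hTp v (Multiset.mem_of_le Multiset.inter_le_left hv))).le
  have hfint : ∀ a : ℝ, IntervalIntegrable
      (fun x => max (c ^ (-a)) (c ^ (Int.fract (x - Real.logb c w) - 1))) volume 0 1 := fun a =>
    intervalIntegrable_of_measurable_of_bound (b := max (c ^ (-a)) 1) (by fun_prop) fun x _ => by
      rw [abs_of_nonneg (le_max_of_le_left (by positivity))]
      refine max_le_max le_rfl (Real.rpow_le_one_of_one_le_of_nonpos hc.le ?_)
      linarith [Int.fract_lt_one (x - Real.logb c w)]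
  -- The parameter stays free: it is log_c(w/r) when t ≤ r, and 1 when t > r.
  have hVge : ∀ a : ℝ, 0 ≤ a → a ≤ 1 → w * c ^ (-a) ≤ r →
      w * ((1 - a) * c ^ (-a) + (1 - c ^ (-a)) / Real.log c)
        ≤ ∫ x in (0 : ℝ)..1, maxSize (accepted c x p) := fun a ha ha1 har => by
    refine (mul_le_mul_of_nonneg_left (le_integral_max_rpow hc ha ha1) hw.le).trans ?_
    rw [← integral_fract_sub (fun y => max (c ^ (-a)) (c ^ (y - 1))) (Real.logb c w),
      ← intervalIntegral.integral_const_mul]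
    refine intervalIntegral.integral_mono_on zero_le_one ((hfint a).const_mul w) hVint
      fun x _ => ?_
    rw [mul_max_of_nonneg _ _ hw.le]
    exact max_le (har.trans (hVr x)) (mul_rpow_fract_le_maxSize_accepted hc hpos hwp)
  rcases le_or_gt t r with htr | htr
  · set a := Real.logb c w - Real.logb c r with ha
    have ha0 : 0 ≤ a := sub_nonneg.2 (Real.logb_le_logb_of_le hc hr0 hrw)
    have hca : c ^ a = w / r := rpow_logb_div hc hr0 hw
    have hca' : c ^ (-a) = r / w := by rw [Real.rpow_neg hc0.le, hca, inv_div]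
    have ha1 : a ≤ 1 := by
      have h1 := Real.logb_le_logb_of_le hc (by positivity) hr.le
      rw [Real.logb_div hw.ne' hc0.ne', Real.logb_self_eq_one hc] at h1
      linarith
    have hV := hVge a ha0 ha1 (by rw [hca', mul_div_cancel₀ _ hw.ne'])
    have hms : MeasurableSet {x | Accepts c x p₀ r ∧
        intervalIndex c x r < intervalIndex c x w} :=
      (measurableSet_accepts c p₀ r).inter (measurableSet_index_lt c r w)
    have hrep := integral_replaced_le hc hp₀pos hp₀ hr hrw hw
    have hrepint := (intervalIntegrable_sum_accepted c hp₀pos).add (intervalIntegrable_ite hms r)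
    -- A dropped t satisfies t ≤ r ≤ V. Otherwise the loss is at most all of A: V covers the job
    -- accepted after r, or r if there is none; the remaining terms cover the earlier accepted jobs,
    -- with r counted there only if it can be replaced.
    have hloss : ∀ x, T.sum - (remaining T t (accepted c x p)).sum ≤
        maxSize (accepted c x p) + ((accepted c x p₀).sum +
        if Accepts c x p₀ r ∧ intervalIndex c x r < intervalIndex c x w then r else 0) := by
      intro x
      have hS0 : 0 ≤ (accepted c x p₀).sum := sum_accepted_nonneg hp₀pos
      have hi0 : 0 ≤ if Accepts c x p₀ r ∧ intervalIndex c x r < intervalIndex c x w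
          then r else 0 := by split_ifs <;> linarith
      rw [sum_sub_sum_remaining ht]
      by_cases h0 : T ∩ (accepted c x p : Multiset ℝ) = 0
      · rw [if_pos h0]
        linarith [hVr x]
      · rw [if_neg h0]
        have h1 : (T ∩ (accepted c x p : Multiset ℝ)).sum ≤ (accepted c x p).sum := by
          rw [← Multiset.sum_coe]
          refine multiset_sum_le_sum_of_le Multiset.inter_le_right fun v hv => ?_
          exact (hpos v (mem_of_mem_accepted (by simpa using hv))).le
        refine h1.trans ?_
        rcases happ x with h | ⟨b, hb, hidx, -, h⟩
        · rw [← hpq] at h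
          have : (accepted c x p).sum ≤ r + (accepted c x p₀).sum := by
            rw [h, accepted]
            split_ifs
            · simp
            · linarith
          linarith [hVr x]
        · rw [← hpq] at h
          have hbV : b ≤ maxSize (accepted c x p) := le_maxSize (by rw [h]; simp)
          have : (accepted c x p).sum = b + (accepted c x (r :: p₀)).sum := by rw [h]; simp
          rw [this, accepted]
          by_cases hacc : Accepts c x p₀ r
          · rw [if_pos hacc, if_pos ⟨hacc, hidx⟩, List.sum_cons]; linarith
          · rw [if_neg hacc, if_neg fun h' => hacc h'.1]; linarith
    have hLint : IntervalIntegrable (fun x => T.sum - (remaining T t (accepted c x p)).sum)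
        volume 0 1 := by
      refine (hVint.add hrepint).mono_fun hmeas.aestronglyMeasurable (ae_of_all _ fun x => ?_)
      beta_reduce
      rw [Real.norm_of_nonneg (hLnn x)]
      exact (hloss x).trans (le_abs_self _)
    have hL := intervalIntegral.integral_mono_on zero_le_one hLint (hVint.add hrepint)
      (fun x _ => hloss x)
    rw [intervalIntegral.integral_add hVint hrepint] at hL
    have hLn : 0 ≤ ∫ x in (0 : ℝ)..1, (T.sum - (remaining T t (accepted c x p)).sum) :=
      intervalIntegral.integral_nonneg zero_le_one fun x _ => hLnn x
    have hh := h_nonneg hc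
    have hmul := h_mul_le hc a
    set V := ∫ x in (0 : ℝ)..1, maxSize (accepted c x p)
    have hRV : h c * (r * (a + 1 / (c - 1))) ≤ (1 - h c) * V := by
      have h1 : r * ((c ^ a - 1) / Real.log c + 1 - a) ≤ V := by
        refine le_trans (le_of_eq ?_) hV
        rw [hca, hca']
        field_simp
        ring
      have h2 : 0 ≤ 1 - h c := by
        rw [one_sub_h_eq hc]; positivity
      calc h c * (r * (a + 1 / (c - 1))) = r * (h c * (a + 1 / (c - 1))) := by ring
        _ ≤ r * ((1 - h c) * ((c ^ a - 1) / Real.log c + 1 - a)) := by gcongr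
        _ = (1 - h c) * (r * ((c ^ a - 1) / Real.log c + 1 - a)) := by ring
        _ ≤ _ := by gcongr
    calc _ ≤ h c * ∫ x in (0 : ℝ)..1, (T.sum - (remaining T t (accepted c x p)).sum) := by
          gcongr; exact min_le_right _ _
      _ ≤ h c * (V + r * (a + 1 / (c - 1))) := by
          gcongr; exact hL.trans (by gcongr)
      _ ≤ V := by linarith
  · have hloss : ∀ x, T.sum - (remaining T t (accepted c x p)).sum ≤ w := by
      intro x
      rw [sum_sub_sum_remaining ht]
      split_ifs with h0
      · exact hle t (hTp t ht)
      -- Everything up to r is smaller than t = min T, so only the single job accepted after r can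
      -- belong to T.
      · have hnot : ∀ v ∈ accepted c x (r :: p₀), v ∉ T := fun v hv hvT => by
          have h1 := htmin v hvT
          rcases List.mem_cons.1 (mem_of_mem_accepted hv) with rfl | h'
          · linarith
          · linarith [hp₀ v h']
        have key : ∃ B : List ℝ, B.sum ≤ w ∧ (∀ v ∈ B, 0 ≤ v) ∧
            accepted c x p = B ++ accepted c x (r :: p₀) := by
          rcases happ x with h | ⟨b, hb, -, -, h⟩
          · exact ⟨[], by simpa using hw.le, by simp, by rw [hpq, h]; rfl⟩
          · exact ⟨[b], by simpa using hleq b hb, by simpa using (hposq b (by simp [hb])).le,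
              by rw [hpq, h]; rfl⟩
        obtain ⟨B, hB, hB0, hAB⟩ := key
        rw [hAB]
        have := multiset_sum_le_sum_of_le (multiset_inter_append_le (B := B) hnot)
          (by simpa using hB0)
        rw [Multiset.sum_coe] at this
        linarith
    have hLint : IntervalIntegrable (fun x => T.sum - (remaining T t (accepted c x p)).sum)
        volume 0 1 := intervalIntegrable_of_measurable_of_bound hmeas fun x _ => by
      rw [abs_of_nonneg (hLnn x)]; exact hloss x
    have hL := intervalIntegral.integral_mono_on zero_le_one hLint
      (intervalIntegrable_const (c := w)) (fun x _ => hloss x)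
    simp only [intervalIntegral.integral_const, smul_eq_mul, sub_zero, one_mul] at hL
    have hV := hVge 1 zero_le_one le_rfl (by
      rw [Real.rpow_neg_one, ← div_eq_mul_inv]; exact hr.le)
    have hα : 0 ≤ (c - 1) / (c * Real.log c) := div_nonneg (by linarith) (by positivity)
    calc _ ≤ (c - 1) / (c * Real.log c) * w := by
          refine mul_le_mul (min_le_left _ _) hL ?_ hα
          exact intervalIntegral.integral_nonneg zero_le_one fun x _ => hLnn x
      _ ≤ _ := by
          refine le_trans (le_of_eq ?_) hV
          rw [Real.rpow_neg_one]
          field_simp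
          ring

/-! ### The cascade of machines -/

/-- The state after the jobs `p` (latest first) have arrived. -/
def runRev {n : ℕ} (c : ℝ) (order : List (Fin n)) (x : Fin n → ℝ) (p : List ℝ) :
    Fin n → List ℝ :=
  p.foldr (fun w held => step c order x held w) (fun _ => [])

theorem run_eq_runRev {n m : ℕ} (c : ℝ) (order : List (Fin n)) (x : Fin n → ℝ) (w : Fin m → ℝ) :
    run c order x w = runRev c order x (List.ofFn w).reverse := by
  rw [run, runRev, List.foldr_reverse]

/-- The cascade: the first machine decides without looking at the others, which then run on its
rejected jobs alone. -/
theorem runRev_cons {n : ℕ} {c : ℝ} {u : Fin n} {us : List (Fin n)} (hu : u ∉ us)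
    (x : Fin n → ℝ) (p : List ℝ) :
    runRev c (u :: us) x p
      = Function.update (runRev c us x (rejected c (x u) p)) u (accepted c (x u) p) := by
  classical
  induction p with
  | nil =>
    funext v
    simp [runRev, rejected, accepted, Function.update_apply]
  | cons w p ih =>
    have h1 : runRev c (u :: us) x (w :: p) = step c (u :: us) x (runRev c (u :: us) x p) w := rfl
    rw [h1, ih, step, accepted, rejected, List.find?_cons]
    simp only [Function.update_self, accepts_accepted_iff]
    by_cases hacc : Accepts c (x u) p w
    · simp [hacc]
    · have h2 : runRev c us x (w :: rejected c (x u) p)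
          = step c us x (runRev c us x (rejected c (x u) p)) w := rfl
      simp only [hacc, decide_false, if_false, h2]
      set st := runRev c us x (rejected c (x u) p)
      have h3 : us.find? (fun v => decide (Accepts c (x v)
            (Function.update st u (accepted c (x u) p) v) w))
          = us.find? (fun v => decide (Accepts c (x v) (st v) w)) := by
        refine List.find?_congr fun v hv => ?_
        have : v ≠ u := fun h => hu (h ▸ hv)
        rw [Function.update_of_ne this]
      rw [h3, step]
      split
      · rename_i v hv
        have hvu : v ≠ u := fun h => hu (h ▸ List.mem_of_find?_eq_some hv)
        rw [Function.update_of_ne hvu, Function.update_comm hvu]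
      · rfl

/-- Later machines do not influence earlier ones, so each prefix can be analysed as a complete
instance. -/
theorem runRev_append {n : ℕ} {c : ℝ} {pre post : List (Fin n)} (hnd : (pre ++ post).Nodup)
    (x : Fin n → ℝ) (p : List ℝ) {u : Fin n} (hu : u ∈ pre) :
    runRev c (pre ++ post) x p u = runRev c pre x p u := by
  induction pre generalizing p with
  | nil => simp at hu
  | cons v pre ih =>
    rw [List.cons_append, List.nodup_cons] at hnd
    have hv : v ∉ pre := fun h => hnd.1 (List.mem_append_left _ h)
    rw [List.cons_append, runRev_cons hnd.1, runRev_cons hv]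
    by_cases huv : u = v
    · subst huv; simp
    · rw [Function.update_of_ne huv, Function.update_of_ne huv]
      exact ih hnd.2 _ ((List.mem_cons.1 hu).resolve_left huv)

theorem runRev_congr {n : ℕ} {c : ℝ} {order : List (Fin n)} (hnd : order.Nodup)
    {x y : Fin n → ℝ} (hxy : ∀ u ∈ order, x u = y u) (p : List ℝ) :
    runRev c order x p = runRev c order y p := by
  induction order generalizing p with
  | nil =>
    induction p with
    | nil => rfl
    | cons w p ih => exact ih
  | cons u us ih =>
    rw [List.nodup_cons] at hnd
    rw [runRev_cons hnd.1, runRev_cons hnd.1, hxy u (by simp),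
      ih hnd.2 fun v hv => hxy v (List.mem_cons_of_mem _ hv)]

theorem step_eq_or {n : ℕ} (c : ℝ) (order : List (Fin n)) (x : Fin n → ℝ)
    (held : Fin n → List ℝ) (w : ℝ) :
    step c order x held w = held ∨
      ∃ u, step c order x held w = Function.update held u (w :: held u) := by
  unfold step
  split
  · exact Or.inr ⟨_, rfl⟩
  · exact Or.inl rfl

theorem mem_of_mem_runRev {n : ℕ} {c : ℝ} {order : List (Fin n)} {x : Fin n → ℝ} {p : List ℝ}
    {u : Fin n} {v : ℝ} (hv : v ∈ runRev c order x p u) : v ∈ p := by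
  induction p with
  | nil => simp [runRev] at hv
  | cons w p ih =>
    have h1 : runRev c order x (w :: p) = step c order x (runRev c order x p) w := rfl
    rcases step_eq_or c order x (runRev c order x p) w with h | ⟨u', h⟩
    · rw [h1, h] at hv
      exact List.mem_cons_of_mem _ (ih hv)
    · rw [h1, h] at hv
      by_cases huu : u = u'
      · subst huu
        rw [Function.update_self] at hv
        rcases List.mem_cons.1 hv with rfl | h
        · simp
        · exact List.mem_cons_of_mem _ (ih h)
      · rw [Function.update_of_ne huu] at hv
        exact List.mem_cons_of_mem _ (ih hv)

/-! ### Measurability of the run and independence of the offsets -/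

open Classical in
theorem measurable_find_accepts {n : ℕ} (c : ℝ) (order : List (Fin n)) (held : Fin n → List ℝ)
    (w : ℝ) {g : Option (Fin n) → (Fin n → ℝ) → ℝ} (hg : ∀ o, Measurable (g o)) :
    Measurable fun x : Fin n → ℝ =>
      g (order.find? (fun u => decide (Accepts c (x u) (held u) w))) x := by
  induction order with
  | nil => simpa only [List.find?_nil] using hg none
  | cons u us ih =>
    have : (fun x : Fin n → ℝ => g ((u :: us).find?
          (fun u => decide (Accepts c (x u) (held u) w))) x)
        = fun x => if Accepts c (x u) (held u) w then g (some u) x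
          else g (us.find? (fun u => decide (Accepts c (x u) (held u) w))) x := by
      funext x
      rw [List.find?_cons]
      by_cases h : Accepts c (x u) (held u) w <;> simp [h]
    rw [this]
    have hpi : Measurable fun x : Fin n → ℝ => x u := measurable_pi_apply u
    have hu : MeasurableSet {x : Fin n → ℝ | Accepts c (x u) (held u) w} :=
      hpi (measurableSet_accepts c (held u) w)
    exact Measurable.ite hu (hg _) ih

/-- Folding forwards keeps the current state `held` independent of `x`: the next job has finitely
many outcomes, each again a constant state. -/
theorem measurable_foldl_step {n : ℕ} (c : ℝ) (order : List (Fin n)) (js : List ℝ)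
    (held : Fin n → List ℝ) (G : (Fin n → List ℝ) → ℝ) :
    Measurable fun x : Fin n → ℝ => G (js.foldl (step c order x) held) := by
  induction js generalizing held with
  | nil => simp only [List.foldl_nil, measurable_const]
  | cons w js ih =>
    let next : Option (Fin n) → Fin n → List ℝ := fun o =>
      match o with
      | some u => Function.update held u (w :: held u)
      | none => held
    exact measurable_find_accepts c order held w
      (g := fun o x => G (js.foldl (step c order x) (next o))) fun o => ih (next o)

theorem measurable_runRev {n : ℕ} (c : ℝ) (order : List (Fin n)) (p : List ℝ)
    (G : (Fin n → List ℝ) → ℝ) : Measurable fun x : Fin n → ℝ => G (runRev c order x p) := by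
  have := measurable_foldl_step c order p.reverse (fun _ => []) G
  simp only [List.foldl_reverse] at this
  exact this

instance : IsProbabilityMeasure (volume.restrict (Ioc (0 : ℝ) 1)) := ⟨by simp⟩

instance (n : ℕ) : IsProbabilityMeasure (offsetLaw n) := by
  unfold offsetLaw; infer_instance

theorem integrable_maxSize_runRev {n : ℕ} (c : ℝ) (order : List (Fin n)) (p : List ℝ)
    (u : Fin n) : Integrable (fun x => maxSize (runRev c order x p u)) (offsetLaw n) :=
  Integrable.of_bound (measurable_runRev c order p fun s => maxSize (s u)).aestronglyMeasurable
    (maxSize p) (ae_of_all _ fun x => by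
      rw [Real.norm_of_nonneg (maxSize_nonneg _)]
      exact maxSize_le (maxSize_nonneg p) fun v hv => le_maxSize (mem_of_mem_runRev hv))

/-- Resampling one offset does not change the law. -/
theorem measurePreserving_update {n : ℕ} (u : Fin n) :
    MeasurePreserving (fun z : ℝ × (Fin n → ℝ) => Function.update z.2 u z.1)
      ((volume.restrict (Ioc (0 : ℝ) 1)).prod (offsetLaw n)) (offsetLaw n) := by
  have hm : Measurable fun z : ℝ × (Fin n → ℝ) => Function.update z.2 u z.1 := by
    rw [measurable_pi_iff]
    intro v
    by_cases h : v = u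
    · subst h; simpa using measurable_fst
    · simp only [Function.update_of_ne h]; fun_prop
  refine ⟨hm, ?_⟩
  unfold offsetLaw
  symm
  refine Measure.pi_eq fun s hs => ?_
  rw [Measure.map_apply hm (MeasurableSet.univ_pi hs)]
  have : (fun z : ℝ × (Fin n → ℝ) => Function.update z.2 u z.1) ⁻¹' univ.pi s
      = s u ×ˢ univ.pi (Function.update s u univ) := by
    ext ⟨a, y⟩
    simp only [mem_preimage, mem_univ_pi, mem_prod]
    constructor
    · intro h
      refine ⟨by simpa using h u, fun v => ?_⟩
      by_cases hv : v = u
      · subst hv; simp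
      · simpa [hv] using h v
    · rintro ⟨h1, h2⟩ v
      by_cases hv : v = u
      · subst hv; simpa using h1
      · simpa [hv] using h2 v
  rw [this, Measure.prod_prod, Measure.pi_pi, ← Finset.mul_prod_erase _ _ (Finset.mem_univ u),
    ← Finset.mul_prod_erase (Finset.univ) (fun v => (volume.restrict (Ioc (0 : ℝ) 1)) (s v))
      (Finset.mem_univ u)]
  rw [Function.update_self, measure_univ, one_mul]
  congr 1
  refine Finset.prod_congr rfl fun v hv => ?_
  rw [Function.update_of_ne (Finset.ne_of_mem_erase hv)]

/-! ### Induction over the machines -/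

/-- Total size of the largest jobs of the machines in `order`. -/
def total {n : ℕ} (c : ℝ) (order : List (Fin n)) (x : Fin n → ℝ) (p : List ℝ) : ℝ :=
  (order.map fun u => maxSize (runRev c order x p u)).sum

theorem total_nonneg {n : ℕ} (c : ℝ) (order : List (Fin n)) (x : Fin n → ℝ) (p : List ℝ) :
    0 ≤ total c order x p :=
  List.sum_nonneg (by simp only [List.mem_map]; rintro _ ⟨u, -, rfl⟩; exact maxSize_nonneg _)

theorem integrable_list_sum {α ι : Type*} {_ : MeasurableSpace α} {μ : Measure α} (l : List ι)
    {f : ι → α → ℝ} (hf : ∀ i ∈ l, Integrable (f i) μ) :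
    Integrable (fun x => (l.map fun i => f i x).sum) μ ∧
      ∫ x, (l.map fun i => f i x).sum ∂μ = (l.map fun i => ∫ x, f i x ∂μ).sum := by
  induction l with
  | nil => simp
  | cons i l ih =>
    have ih := ih fun j hj => hf j (List.mem_cons_of_mem _ hj)
    have hi := hf i (by simp)
    simp only [List.map_cons, List.sum_cons]
    exact ⟨hi.add ih.1, by rw [integral_add hi ih.1, ih.2]⟩

theorem integrable_total {n : ℕ} (c : ℝ) (order : List (Fin n)) (p : List ℝ) :
    Integrable (fun x => total c order x p) (offsetLaw n) :=
  (integrable_list_sum order fun u _ => integrable_maxSize_runRev c order p u).1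

theorem total_cons_update {n : ℕ} {c : ℝ} {u : Fin n} {us : List (Fin n)}
    (hnd : (u :: us).Nodup) (a : ℝ) (x : Fin n → ℝ) (p : List ℝ) :
    total c (u :: us) (Function.update x u a) p
      = maxSize (accepted c a p) + total c us x (rejected c a p) := by
  rw [List.nodup_cons] at hnd
  have hne : ∀ v ∈ us, v ≠ u := fun v hv h => hnd.1 (h ▸ hv)
  have hx : ∀ p, runRev c us (Function.update x u a) p = runRev c us x p := fun p =>
    runRev_congr hnd.2 (fun v hv => Function.update_of_ne (hne v hv) _ _) p
  rw [total, List.map_cons, List.sum_cons, runRev_cons hnd.1, Function.update_self,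
    Function.update_self, hx, total]
  congr 2
  refine List.map_congr_left fun v hv => ?_
  rw [Function.update_of_ne (hne v hv)]

/-- The expected total size of the largest jobs is at least `ratio c` times the total size of any
collection of as many jobs as there are machines. -/
theorem ratio_mul_sum_le_integral_total {n : ℕ} {c : ℝ} (hc : 1 < c) {order : List (Fin n)}
    (hnd : order.Nodup) {p : List ℝ} (hpos : ∀ v ∈ p, 0 < v) {T : Multiset ℝ} (hT : T ≤ p)
    (hcard : T.card ≤ order.length) :
    ratio c * T.sum ≤ ∫ x, total c order x p ∂(offsetLaw n) := by
  induction order generalizing p T with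
  | nil =>
    have : T = 0 := Multiset.card_eq_zero.1 (by simpa using hcard)
    simp [this, total]
  | cons u us ih =>
    by_cases hT0 : T = 0
    · subst hT0
      simpa using integral_nonneg fun x => total_nonneg c (u :: us) x p
    obtain ⟨t, ht, htmin⟩ : ∃ t ∈ T, ∀ v ∈ T, t ≤ v := by
      obtain ⟨t, ht, h⟩ := T.toFinset.exists_min_image id
        (by rwa [Multiset.toFinset_nonempty])
      exact ⟨t, by simpa using ht, fun v hv => h v (by simpa using hv)⟩
    have hmp := measurePreserving_update u
    have hI := integrable_total c (u :: us) p
    have hI2 := hmp.integrable_comp_of_integrable hI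
    -- Resampling the offset of u separates it from the others, so the induction hypothesis applies
    -- for each fixed a to the jobs rejected with offset a.
    have hchange : ∫ x, total c (u :: us) x p ∂(offsetLaw n)
        = ∫ a in (0 : ℝ)..1, ∫ x, total c (u :: us) (Function.update x u a) p ∂(offsetLaw n) := by
      rw [intervalIntegral.integral_of_le zero_le_one, ← hmp.map_eq,
        integral_map hmp.measurable.aemeasurable
          (by rw [hmp.map_eq]; exact hI.aestronglyMeasurable), hmp.map_eq]
      exact integral_prod _ hI2
    rw [hchange]
    have hinner : IntervalIntegrable
        (fun a => ∫ x, total c (u :: us) (Function.update x u a) p ∂(offsetLaw n)) volume 0 1 := by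
      rw [intervalIntegrable_iff_integrableOn_Ioc_of_le zero_le_one]
      exact hI2.integral_prod_left
    have hloss := ratio_mul_integral_loss_le hc hpos hT ht htmin
    have hVint := intervalIntegrable_maxSize_accepted c p
    have hTpos : ∀ v ∈ T, 0 ≤ v := fun v hv =>
      (hpos v (by simpa using Multiset.mem_of_le hT hv)).le
    have hRint : IntervalIntegrable (fun x => (remaining T t (accepted c x p)).sum) volume 0 1 := by
      refine intervalIntegrable_of_measurable_of_bound (b := T.sum)
        (measurable_accepted_rejected c p fun a _ => (remaining T t a).sum) fun x _ => ?_
      have hle : remaining T t (accepted c x p) ≤ T := by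
        unfold remaining
        split_ifs
        · exact Multiset.erase_le _ _
        · exact Multiset.sub_le_self _ _
      rw [abs_of_nonneg (Multiset.sum_nonneg fun v hv => hTpos v (Multiset.mem_of_le hle hv))]
      exact multiset_sum_le_sum_of_le hle hTpos
    have hmono := intervalIntegral.integral_mono_on zero_le_one
      (hVint.add (hRint.const_mul (ratio c))) hinner (fun a _ => by
        simp only [total_cons_update hnd]
        rw [integral_add (integrable_const _) (integrable_total _ _ _), integral_const]
        have := ih (List.nodup_cons.1 hnd).2
          (fun v hv => hpos v (mem_of_mem_rejected hv))
          (remaining_le_rejected (c := c) (x := a) hT t)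
          (by have := card_remaining_lt ht (accepted c a p)
              rw [List.length_cons] at hcard
              omega)
        simpa using this)
    rw [intervalIntegral.integral_add hVint (hRint.const_mul _),
      intervalIntegral.integral_const_mul] at hmono
    rw [intervalIntegral.integral_sub intervalIntegrable_const hRint] at hloss
    simp only [intervalIntegral.integral_const, smul_eq_mul, sub_zero, one_mul] at hloss
    refine le_trans ?_ hmono
    linarith

/-! ### Comparison with the offline optimum -/

/-- Abel summation with a carry: `e` is the partial sum so far, weighted by an earlier `s₀`;
lowering its weight to `s u` only decreases the expression. -/
theorem abel_nonneg {ι : Type*} {s d : ι → ℝ} {l : List ι} {s₀ e : ℝ} (he : 0 ≤ e)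
    (hs₀ : ∀ u ∈ l, s u ≤ s₀) (hs₀' : 0 ≤ s₀) (hs : ∀ u ∈ l, 0 ≤ s u)
    (hl : l.Pairwise fun u v => s v ≤ s u)
    (hd : ∀ pre post, pre ++ post = l → 0 ≤ e + (pre.map d).sum) :
    0 ≤ s₀ * e + (l.map fun u => s u * d u).sum := by
  induction l generalizing s₀ e with
  | nil => simpa using mul_nonneg hs₀' he
  | cons u l ih =>
    rw [List.pairwise_cons] at hl
    have he' : 0 ≤ e + d u := by simpa using hd [u] l rfl
    have h1 := ih he' hl.1 (hs u (by simp)) (fun v hv => hs v (List.mem_cons_of_mem _ hv)) hl.2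
      (fun pre post h => by
        have := hd (u :: pre) post (by rw [List.cons_append, h])
        rw [List.map_cons, List.sum_cons] at this
        linarith)
    have h2 : s u * e ≤ s₀ * e := mul_le_mul_of_nonneg_right (hs₀ u (by simp)) he
    rw [List.map_cons, List.sum_cons]
    linarith

/-- If the partial sums of `a` are at most those of `b`, then the same holds for the sums weighted
by nonnegative decreasing `s`. -/
theorem sum_mul_le_sum_mul_of_partial_sums {ι : Type*} {s a b : ι → ℝ} {l : List ι}
    (hs : ∀ u, 0 ≤ s u) (hl : l.Pairwise fun u v => s v ≤ s u)
    (hab : ∀ pre post, pre ++ post = l → (pre.map a).sum ≤ (pre.map b).sum) :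
    (l.map fun u => s u * a u).sum ≤ (l.map fun u => s u * b u).sum := by
  have hsub : ∀ (l : List ι) (f g : ι → ℝ),
      (l.map fun u => g u - f u).sum = (l.map g).sum - (l.map f).sum := fun l f g => by
    induction l with
    | nil => simp
    | cons u l ih => simp only [List.map_cons, List.sum_cons, ih]; ring
  have h := abel_nonneg (s := s) (d := fun u => b u - a u) (l := l) (s₀ := (l.map s).sum) (e := 0)
    le_rfl
    (fun u hu => List.single_le_sum (by simpa using fun v _ => hs v) _ (List.mem_map_of_mem hu))
    (List.sum_nonneg (by simpa using fun v _ => hs v)) (fun u _ => hs u) hl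
    (fun pre post hpp => by rw [hsub, zero_add]; linarith [hab pre post hpp])
  simp only [mul_zero, zero_add, mul_sub] at h
  rw [hsub] at h
  linarith

/-- Choosing a largest job on each nonempty machine gives distinct jobs, since `f` sends a job to at
most one machine. This turns the optimum into a comparison collection. -/
theorem exists_finset_sum_eq_maxSize {n m : ℕ} {w : Fin m → ℝ} (hw : ∀ j, 0 < w j)
    (f : Fin m → Option (Fin n)) {l : List (Fin n)} (hl : l.Nodup) :
    ∃ J : Finset (Fin m), J.card ≤ l.length ∧ (∀ j ∈ J, ∃ u ∈ l, f j = some u) ∧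
      ∑ j ∈ J, w j = (l.map fun u => maxSize (heldBy w f u)).sum := by
  classical
  induction l with
  | nil => exact ⟨∅, by simp⟩
  | cons u l ih =>
    rw [List.nodup_cons] at hl
    obtain ⟨J, hcard, hJ, hsum⟩ := ih hl.2
    by_cases hn : heldBy w f u = []
    · refine ⟨J, by simp only [List.length_cons]; omega, fun j hj => ?_, ?_⟩
      · obtain ⟨v, hv, hfv⟩ := hJ j hj
        exact ⟨v, List.mem_cons_of_mem _ hv, hfv⟩
      · rw [List.map_cons, List.sum_cons, hn, maxSize_nil, zero_add, hsum]
    · have hmem := maxSize_mem hn (fun v hv => by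
        obtain ⟨j, -, rfl⟩ := List.mem_map.1 hv
        exact hw j)
      obtain ⟨j, hj, hwj⟩ := List.mem_map.1 hmem
      have hfj : f j = some u := by simpa using (List.mem_filter.1 hj).2
      have hjJ : j ∉ J := fun h => by
        obtain ⟨v, hv, hfv⟩ := hJ j h
        rw [hfj, Option.some.injEq] at hfv
        exact hl.1 (hfv ▸ hv)
      refine ⟨insert j J, ?_, fun i hi => ?_, ?_⟩
      · rw [Finset.card_insert_of_notMem hjJ, List.length_cons]; omega
      · rcases Finset.mem_insert.1 hi with rfl | hi
        · exact ⟨u, by simp, hfj⟩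
        · obtain ⟨v, hv, hfv⟩ := hJ i hi
          exact ⟨v, List.mem_cons_of_mem _ hv, hfv⟩
      · rw [Finset.sum_insert hjJ, List.map_cons, List.sum_cons, hsum, hwj]

theorem reward_eq_sum_map {n : ℕ} {s : Fin n → ℝ} {order : List (Fin n)}
    (ho : IsSpeedOrder s order) (held : Fin n → List ℝ) :
    reward s held = (order.map fun u => s u * maxSize (held u)).sum := by
  rw [reward, ← List.sum_toFinset _ ho.1]
  congr 1
  ext u
  simp [ho.2.1 u]

theorem opt_nonneg {n m : ℕ} {s : Fin n → ℝ} (hs : ∀ u, 0 ≤ s u) (w : Fin m → ℝ) :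
    0 ≤ opt s w := by
  obtain ⟨f, hf⟩ := (opt_isGreatest s w).1
  rw [← hf]
  exact Finset.sum_nonneg fun u _ => mul_nonneg (hs u) (maxSize_nonneg _)

theorem isCompetitive_ratio {c : ℝ} (hc : 1 < c) : IsCompetitive c (ratio c) := by
  intro n m s order w hs hw ho
  set p := (List.ofFn w).reverse with hp
  have hpos : ∀ v ∈ p, 0 < v := fun v hv => by
    rw [hp, List.mem_reverse, List.mem_ofFn] at hv
    obtain ⟨j, rfl⟩ := hv
    exact hw j
  have hrun : (fun x => reward s (run c order x w))
      = fun x => (order.map fun u => s u * maxSize (runRev c order x p u)).sum := by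
    funext x
    rw [reward_eq_sum_map ho, run_eq_runRev]
  have hI := integrable_list_sum order (f := fun u x => s u * maxSize (runRev c order x p u))
    (μ := offsetLaw n) fun u _ => (integrable_maxSize_runRev c order p u).const_mul (s u)
  rw [hrun]
  refine ⟨hI.1, ?_⟩
  rw [hI.2]
  obtain ⟨f, hf⟩ := (opt_isGreatest s w).1
  simp only at hf
  rw [← hf, reward_eq_sum_map ho, ← List.sum_map_mul_left]
  simp only [integral_const_mul]
  have hcomm : (fun u => ratio c * (s u * maxSize (heldBy w f u)))
      = fun u => s u * (ratio c * maxSize (heldBy w f u)) := by funext u; ring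
  rw [hcomm]
  refine sum_mul_le_sum_mul_of_partial_sums hs ho.2.2 fun pre post hpp => ?_
  have hnd : (pre ++ post).Nodup := hpp ▸ ho.1
  have hpre : pre.Nodup := (List.nodup_append.1 hnd).1
  obtain ⟨J, hcard, -, hsum⟩ := exists_finset_sum_eq_maxSize hw f hpre
  have hT : J.val.map w ≤ (p : Multiset ℝ) := by
    have h1 : (p : Multiset ℝ) = Finset.univ.val.map w := by
      rw [hp, Multiset.coe_reverse, List.ofFn_eq_map, ← Multiset.map_coe]
      rfl
    rw [h1]
    exact Multiset.map_le_map (Finset.val_le_iff.2 (Finset.subset_univ J))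
  have h := ratio_mul_sum_le_integral_total hc hpre hpos hT (by simpa using hcard)
  rw [List.sum_map_mul_left, ← hsum]
  refine h.trans (le_of_eq ?_)
  have h2 := integrable_list_sum pre (f := fun u x => maxSize (runRev c pre x p u))
    (μ := offsetLaw n) fun u _ => integrable_maxSize_runRev c pre p u
  unfold total
  rw [h2.2]
  congr 1
  refine List.map_congr_left fun u hu => ?_
  congr 1
  funext x
  rw [← hpp, runRev_append hnd x p hu]

theorem IsCompetitive.mono {c a b : ℝ} (h : IsCompetitive c b) (hab : a ≤ b) :
    IsCompetitive c a := fun n m s order w hs hw ho =>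
  ⟨(h n m s order w hs hw ho).1,
    (mul_le_mul_of_nonneg_right hab (opt_nonneg hs w)).trans (h n m s order w hs hw ho).2⟩

/-! ### Numerical bounds -/

theorem log_mem_Ioo : Real.log 3.55829 ∈ Ioo (1.26927 : ℝ) 1.26929 := by
  constructor
  · rw [Real.lt_log_iff_exp_lt (by norm_num), show (1.26927 : ℝ) = 1 + 0.26927 by norm_num,
      Real.exp_add]
    have h1 := Real.exp_one_lt_d9
    have h2 : Real.exp 0.26927 ≤ 1.309012 := by
      refine (Real.exp_bound' (n := 7) (by norm_num) (by norm_num) (by norm_num)).trans ?_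
      simp only [Finset.sum_range_succ, Finset.sum_range_zero, Nat.factorial]
      norm_num
    calc Real.exp 1 * Real.exp 0.26927 ≤ 2.7182818286 * 1.309012 := by gcongr
      _ < 3.55829 := by norm_num
  · rw [Real.log_lt_iff_lt_exp (by norm_num), show (1.26929 : ℝ) = 1 + 0.26929 by norm_num,
      Real.exp_add]
    have h1 := Real.exp_one_gt_d9
    have h2 : 1.309030 ≤ Real.exp 0.26929 := by
      refine le_trans ?_ (Real.sum_le_exp_of_nonneg (by norm_num) 7)
      simp only [Finset.sum_range_succ, Finset.sum_range_zero, Nat.factorial]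
      norm_num
    calc (3.55829 : ℝ) < 2.7182818283 * 1.309030 := by norm_num
      _ ≤ Real.exp 1 * Real.exp 0.26929 := by gcongr

theorem ratio_mem_Ioo : ratio 3.55829 ∈ Ioo (0.5664 : ℝ) 0.5665 := by
  have hl := log_mem_Ioo
  have hlpos : 0 < Real.log 3.55829 := by linarith [hl.1]
  have hc : (1 : ℝ) < 3.55829 := by norm_num
  have h1 : ((3.55829 : ℝ) - 1) / (3.55829 * Real.log 3.55829) < 0.5665 := by
    rw [div_lt_iff₀ (by positivity)]
    linarith [hl.1]
  have h2 : 0.5664 < ((3.55829 : ℝ) - 1) / (3.55829 * Real.log 3.55829) := by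
    rw [lt_div_iff₀ (by positivity)]
    linarith [hl.2]
  have h3 : 0.5664 < h 3.55829 := by
    -- If h ≤ 0.5664, then βh ≤ 0.76545 · 0.5664 < 0.433551, and the fixed-point equation gives 1 -
    -- h < 0.4336, a contradiction. This avoids evaluating `lambertW`.
    by_contra! hle
    have heq := one_sub_h_eq hc
    have hb0 := beta_pos hc
    have hb : beta 3.55829 < 0.76545 := by
      rw [beta, sub_lt_iff_lt_add, div_lt_iff₀ (by norm_num)]
      linarith [hl.2]
    have hexp : Real.exp (beta 3.55829 * h 3.55829) ≤ 1.54276 := by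
      have h4 : beta 3.55829 * h 3.55829 ≤ 0.433551 := by
        have := h_nonneg hc
        nlinarith
      refine (Real.exp_le_exp.2 h4).trans ?_
      refine (Real.exp_bound' (n := 7) (by norm_num) (by norm_num) (by norm_num)).trans ?_
      simp only [Finset.sum_range_succ, Finset.sum_range_zero, Nat.factorial]
      norm_num
    have h5 : Real.exp (beta 3.55829 * h 3.55829) / 3.55829 ≤ 1.54276 / 3.55829 := by gcongr
    have h6 : (1.54276 : ℝ) / 3.55829 < 0.4336 := by norm_num
    linarith
  exact ⟨lt_min h2 h3, (min_le_left _ _).trans_lt h1⟩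

end OnlineMatching

end

/-- The last two conjuncts say that, for `c = 3.55829`, the ratio equals `0.5664` up to four digits
and that the algorithm is `0.5664`-competitive, which is strictly better than `1/2`. -/
theorem theorem2 :
    (∀ c : ℝ, Real.exp 1 ≤ c → OnlineMatching.IsCompetitive c (OnlineMatching.ratio c)) ∧
    OnlineMatching.ratio 3.55829 ∈ Set.Ioo (0.5664 : ℝ) 0.5665 ∧
    OnlineMatching.IsCompetitive 3.55829 0.5664 :=
  ⟨fun _ hc => OnlineMatching.isCompetitive_ratio
      ((Real.one_lt_exp_iff.2 one_pos).trans_le hc),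
    OnlineMatching.ratio_mem_Ioo,
    (OnlineMatching.isCompetitive_ratio (by norm_num)).mono OnlineMatching.ratio_mem_Ioo.1.le⟩
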